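/- **Theorem.** Let $n\ge 1$, and let $\mathbf{x}$ and $\mathbf{s}$ (the centres of a spherical robot of radius $r_1\ge 0$ and of a spherical obstacle of radius $s_1\ge 0$ in $\mathbb{R}^n$) be independent random vectors with $\mathbf{x}\sim\mathcal N(\mu_x,\Sigma_x)$ and $\mathbf{s}\sim\mathcal N(\mu_s,\Sigma_s)$, where $\Sigma_x,\Sigma_s$ are positive semidefinite and $\Sigma:=\Sigma_x+\Sigma_s$ is positive definite. Put $\mu:=\mu_x-\mu_s$ and $y:=(r_1+s_1)^2$. Then $\mathbf{w}:=\mathbf{x}-\mathbf{s}\sim\mathcal N(\mu,\Sigma)$, and the event that the two closed balls (of radius $r_1$ about $\mathbf{x}$ and of radius $s_1$ about $\mathbf{s}$) intersect is the event $\|\mathbf{x}-\mathbf{s}\|^2\le y$, that is, $Q(\mathbf{w})\le y$ for the quadratic form $Q(\mathbf{w})=\mathbf{w}^T A\mathbf{w}$ with $A=I$. Moreover, let $P$ be any orthogonal matrix such that $P^T\Sigma^{1/2}A\Sigma^{1/2}P=\mathrm{diag}(\lambda_1,\dots,\lambda_n)$, where $A=I$ and $\Sigma^{1/2}$ is the positive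 semidefinite square root of $\Sigma$, and let $(b_1,\dots,b_n)^T:=P^T\Sigma^{-1/2}\mu$. Define $$c_0=\exp\Big(-\tfrac12\sum_{i=1}^n b_i^2\Big)\prod_{i=1}^n(2\lambda_i)^{-1/2},\qquad d_k=\tfrac12\sum_{i=1}^n(1-k\,b_i^2)(2\lambda_i)^{-k},\qquad c_k=\frac1k\sum_{j=0}^{k-1}d_{k-j}\,c_j\quad(k\ge1).$$ Then the following series converges (unconditionally), and the collision probability is its sum: $$P\big(\|\mathbf{x}-\mathbf{s}\|^2\le (r_1+s_1)^2\big)=\sum_{k=0}^{\infty}(-1)^k c_k\,\frac{y^{\frac n2+k}}{\Gamma\left(\frac n2+k+1\right)}.$$ -/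

import Mathlib

open MeasureTheory ProbabilityTheory
open scoped MatrixOrder

/-- The parameters of the quadratic form `Q(x) = xᵀ A x` in a random vector `x` with mean `μ` and
covariance matrix `S`: `P` is an orthogonal matrix with
`Pᵀ S^{1/2} A S^{1/2} P = diag (lam 1, …, lam n)`, and `b = Pᵀ S^{-1/2} μ`. Here `S^{1/2}` is the
positive semidefinite square root of `S`. -/
structure IsQuadFormParams {n : ℕ} (A S : Matrix (Fin n) (Fin n) ℝ)
    (μ : EuclideanSpace ℝ (Fin n)) (P : Matrix (Fin n) (Fin n) ℝ) (lam b : Fin n → ℝ) :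
    Prop where
  orthogonal : P * P.transpose = 1
  diagonalizes :
    P.transpose * (CFC.sqrt S * A * CFC.sqrt S) * P = Matrix.diagonal lam
  shift : b = P.transpose.mulVec ((CFC.sqrt S)⁻¹.mulVec μ)

/-- Parameters of the quadratic form exist for every symmetric matrix `A`. -/
theorem exists_isQuadFormParams {n : ℕ} (A S : Matrix (Fin n) (Fin n) ℝ)
    (hA : A.IsHermitian) (μ : EuclideanSpace ℝ (Fin n)) :
    ∃ (P : Matrix (Fin n) (Fin n) ℝ) (lam b : Fin n → ℝ), IsQuadFormParams A S μ P lam b := by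
  have hR : (CFC.sqrt S).IsHermitian := (CFC.sqrt_nonneg S).isSelfAdjoint
  have hM : (CFC.sqrt S * A * CFC.sqrt S).IsHermitian := by
    have h := Matrix.isHermitian_mul_mul_conjTranspose (CFC.sqrt S) hA
    rwa [hR.eq] at h
  refine ⟨hM.eigenvectorUnitary, hM.eigenvalues, _, ?_, ?_, rfl⟩
  · have h := Unitary.mul_star_self_of_mem hM.eigenvectorUnitary.2
    simpa only [Matrix.star_eq_conjTranspose, Matrix.conjTranspose_eq_transpose_of_trivial] using h
  · have h := hM.conjStarAlgAut_star_eigenvectorUnitary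
    simpa [Unitary.conjStarAlgAut_apply, Matrix.star_eq_conjTranspose,
      Matrix.conjTranspose_eq_transpose_of_trivial, Function.comp_def] using h

/-- `d_k = (1/2) ∑ i, (1 - k b_i²) (2 λ_i)^{-k}`, used for `k ≥ 1`. -/
noncomputable def quadFormD {n : ℕ} (lam b : Fin n → ℝ) (k : ℕ) : ℝ :=
  (1 / 2) * ∑ i, (1 - (k : ℝ) * b i ^ 2) * ((2 * lam i) ^ k)⁻¹

/-- `c_0 = exp (-(1/2) ∑ i, b_i²) ∏ i, (2 λ_i)^{-1/2}` and
`c_k = (1/k) ∑_{j=0}^{k-1} d_{k-j} c_j` for `k ≥ 1`. -/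
noncomputable def quadFormC {n : ℕ} (lam b : Fin n → ℝ) : ℕ → ℝ
  | 0 => Real.exp (-(1 / 2) * ∑ i, b i ^ 2) * ∏ i, (2 * lam i) ^ (-(1 / 2) : ℝ)
  | k + 1 => (1 / ((k : ℝ) + 1)) *
      ∑ j : Fin (k + 1), quadFormD lam b (k + 1 - (j : ℕ)) * quadFormC lam b (j : ℕ)
  decreasing_by exact j.2

/-- The `k`-th term `(-1)^k c_k y^{n/2+k} / Γ(n/2+k+1)` of the series for the cdf of the
quadratic form. -/
noncomputable def quadFormCdfTerm {n : ℕ} (lam b : Fin n → ℝ) (y : ℝ) (k : ℕ) : ℝ :=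
  (-1) ^ k * quadFormC lam b k * (y ^ ((n : ℝ) / 2 + k) / Real.Gamma ((n : ℝ) / 2 + k + 1))

/-- The collision event: the closed ball of radius `r₁` occupied by the robot, centred at `x`,
meets the closed ball of radius `s₁` occupied by the obstacle, centred at `s`. -/
def collisionEvent {Ω : Type*} {n : ℕ} (x s : Ω → EuclideanSpace ℝ (Fin n)) (r₁ s₁ : ℝ) :
    Set Ω :=
  {ω | (Metric.closedBall (x ω) r₁ ∩ Metric.closedBall (s ω) s₁).Nonempty}

/-!
The difference `w = x - s` of independent Gaussian vectors is Gaussian, and two closed balls meet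
exactly when the distance of their centres is at most the sum of the radii, so the collision
probability is the distribution function of `‖w‖²` at `y`. The series for that function is found by
inverting a Laplace transform.

In the coordinates given by `P` the vector `w` becomes `z + b` with independent standard Gaussian
coordinates `z_i`, and `‖w‖² = ∑ λ_i (z_i + b_i)²` (`norm_sq_eq_sum_of_isQuadFormParams`). One
Gaussian integral for each coordinate gives
`E exp (-s ‖w‖²) = ∏ (1 + 2 λ_i s)^{-1/2} exp (-(b_i²/2) · 2 λ_i s / (1 + 2 λ_i s))`
(`integral_exp_neg_norm_sq_multivariateGaussian`). With `u = 1 / s` this is `u^{n/2} G(u)`, where `G`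
is analytic at `0`; the logarithmic derivative of `G` is `∑_{m ≥ 0} (-1)^{m+1} d_{m+1} u^m`, so the
recursion for the `c_k` says precisely that `G(u) = ∑ (-1)^k c_k u^k` (`hasSum_quadFormC`).

The recursion also bounds `|c_k|` by a geometric sequence `c_0 τ^k`. For `s > τ` the series
`f(y) = ∑ (-1)^k c_k y^{n/2+k-1} / Γ(n/2+k)` may therefore be integrated termwise against
`exp (-s y)`, and its Laplace transform is that of the law of `‖w‖²`
(`hasSum_laplace_gammaSeries`). Laplace transforms determine a measure on `[0, ∞)` with a signed
density (`measureReal_Iic_eq_of_laplace`): after the weight `exp (-s y)` is put in and the negative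
part of the density is moved to the other side, two finite measures are compared, whose images under
`y ↦ exp (-y)` live on `[0, 1]` and have the same moments. Hence `f` is the density of `‖w‖²`, and
termwise integration over `(0, y]` gives the series (`hasSum_integral_Ioc_gammaSeries`). No density
exists in dimension zero, where the series reduces to its first term.
-/

/-! ### Power series with a logarithmic derivative -/

theorem abs_le_geometric_of_recursion {a e : ℕ → ℝ} {τ : ℝ} (hτ : 0 ≤ τ)
    (he : ∀ m, |e m| ≤ τ ^ (m + 1))
    (hrec : ∀ k : ℕ, ((k : ℝ) + 1) * a (k + 1) = ∑ j ∈ Finset.range (k + 1), a j * e (k - j))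
    (k : ℕ) : |a k| ≤ |a 0| * τ ^ k := by
  induction k using Nat.strong_induction_on with
  | _ k ih =>
    rcases k with _ | k
    · simp
    have hk : (0 : ℝ) < (k : ℝ) + 1 := by positivity
    have h1 : ((k : ℝ) + 1) * |a (k + 1)| ≤ ((k : ℝ) + 1) * (|a 0| * τ ^ (k + 1)) := by
      rw [← abs_of_pos hk, ← abs_mul, hrec k, abs_of_pos hk]
      calc |∑ j ∈ Finset.range (k + 1), a j * e (k - j)|
          ≤ ∑ j ∈ Finset.range (k + 1), |a j * e (k - j)| := Finset.abs_sum_le_sum_abs _ _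
        _ ≤ ∑ _j ∈ Finset.range (k + 1), |a 0| * τ ^ (k + 1) := by
            refine Finset.sum_le_sum fun j hj => ?_
            have hjk : j ≤ k := Nat.lt_succ_iff.mp (Finset.mem_range.mp hj)
            rw [abs_mul]
            calc |a j| * |e (k - j)| ≤ (|a 0| * τ ^ j) * τ ^ (k - j + 1) :=
                  mul_le_mul (ih j (by omega)) (he _) (abs_nonneg _) (by positivity)
              _ = |a 0| * τ ^ (k + 1) := by
                  rw [mul_assoc, ← pow_add]; congr 2; omega
        _ = ((k : ℝ) + 1) * (|a 0| * τ ^ (k + 1)) := by simp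
    exact le_of_mul_le_mul_left h1 hk

theorem summable_norm_mul_pow {a : ℕ → ℝ} {M τ u : ℝ} (hτ : 0 ≤ τ)
    (ha : ∀ k, |a k| ≤ M * τ ^ k) (hu : |u| * τ < 1) : Summable fun k => ‖a k * u ^ k‖ := by
  refine Summable.of_nonneg_of_le (fun _ => norm_nonneg _) (fun k => ?_)
    ((summable_geometric_of_lt_one (by positivity) hu).mul_left M)
  rw [norm_mul, norm_pow, Real.norm_eq_abs, Real.norm_eq_abs, mul_pow]
  calc |a k| * |u| ^ k ≤ M * τ ^ k * |u| ^ k := by gcongr; exact ha k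
    _ = _ := by ring

theorem hasDerivAt_tsum_mul_pow {a : ℕ → ℝ} {M τ u : ℝ} (hτ : 0 < τ)
    (ha : ∀ k, |a k| ≤ M * τ ^ k) (hu : |u| * τ < 1) :
    HasDerivAt (fun x => ∑' k, a k * x ^ k) (∑' k : ℕ, ((k : ℝ) + 1) * a (k + 1) * u ^ k) u := by
  -- termwise differentiation needs a uniform bound, taken on a ball of radius `r < 1 / τ`
  obtain ⟨r, hur, hr⟩ := exists_between ((lt_div_iff₀ hτ).mpr hu)
  have hr0 : 0 < r := (abs_nonneg u).trans_lt hur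
  have hrτ : r * τ < 1 := (lt_div_iff₀ hτ).mp hr
  have hM : 0 ≤ M := by simpa using (abs_nonneg _).trans (ha 0)
  have hsum : Summable fun k : ℕ => M / r * ((k : ℝ) ^ 1 * (r * τ) ^ k) := by
    refine Summable.mul_left _ (summable_pow_mul_geometric_of_norm_lt_one 1 ?_)
    rwa [Real.norm_eq_abs, abs_of_pos (by positivity)]
  have hbound : ∀ (k : ℕ) (x : ℝ), x ∈ Metric.ball (0 : ℝ) r →
      ‖a k * ((k : ℝ) * x ^ (k - 1))‖ ≤ M / r * ((k : ℝ) ^ 1 * (r * τ) ^ k) := by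
    intro k x hx
    have hx' : |x| < r := by simpa using hx
    rcases k with _ | k
    · simp
    rw [norm_mul, norm_mul, norm_pow, Real.norm_eq_abs, Real.norm_eq_abs, Real.norm_eq_abs,
      Nat.abs_cast, Nat.add_sub_cancel, pow_one]
    calc |a (k + 1)| * (((k + 1 : ℕ) : ℝ) * |x| ^ k)
        ≤ (M * τ ^ (k + 1)) * (((k + 1 : ℕ) : ℝ) * r ^ k) := by
          gcongr
          exact ha _
      _ = _ := by field_simp; ring
  have h := hasDerivAt_tsum_of_isPreconnected (g := fun k x => a k * x ^ k)
    (g' := fun k x => a k * ((k : ℝ) * x ^ (k - 1))) hsum Metric.isOpen_ball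
    (convex_ball (0 : ℝ) r).isPreconnected
    (fun k x _ => (hasDerivAt_pow k x).const_mul (a k)) hbound (Metric.mem_ball_self hr0)
    (summable_of_ne_finset_zero (s := {0}) (by
      intro k hk
      simp only [Finset.mem_singleton] at hk
      simp [hk])) (by simpa using hur : u ∈ Metric.ball (0 : ℝ) r)
  have hs : Summable fun k : ℕ => a k * ((k : ℝ) * u ^ (k - 1)) :=
    Summable.of_norm_bounded hsum fun k => hbound k u (by simpa using hur)
  rw [hs.tsum_eq_zero_add] at h
  simp only [Nat.cast_zero, zero_mul, mul_zero, zero_add, Nat.cast_add, Nat.cast_one,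
    Nat.add_sub_cancel] at h
  rwa [tsum_congr fun k : ℕ => show ((k : ℝ) + 1) * a (k + 1) * u ^ k
    = a (k + 1) * (((k : ℝ) + 1) * u ^ k) by ring]

/-- If the coefficients `a` satisfy the recursion which expresses `A' = E * A` for the generating
functions `A` of `a` and `E` of `e`, and `E` is the derivative of `L`, then `A` is a multiple of
`exp L`: the function `A * exp (-L)` has derivative zero. -/
theorem hasSum_exp_of_recursion {a e : ℕ → ℝ} {τ u : ℝ} {L : ℝ → ℝ} (hτ : 0 < τ)
    (he : ∀ m, |e m| ≤ τ ^ (m + 1))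
    (hrec : ∀ k : ℕ, ((k : ℝ) + 1) * a (k + 1) = ∑ j ∈ Finset.range (k + 1), a j * e (k - j))
    (hL : ∀ x, 0 ≤ x → x * τ < 1 → HasDerivAt L (∑' m, e m * x ^ m) x)
    (hu0 : 0 ≤ u) (hu : u * τ < 1) :
    HasSum (fun k => a k * u ^ k) (a 0 * Real.exp (L u - L 0)) := by
  have ha := abs_le_geometric_of_recursion hτ.le he hrec
  have he' : ∀ m, |e m| ≤ τ * τ ^ m := fun m => (he m).trans_eq (by ring)
  set A : ℝ → ℝ := fun x => ∑' k, a k * x ^ k with hA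
  have hder : ∀ x, 0 ≤ x → x * τ < 1 → HasDerivAt (fun x => A x * Real.exp (-L x)) 0 x := by
    intro x hx0 hx
    have hx' : |x| * τ < 1 := by rwa [abs_of_nonneg hx0]
    have h1 := hasDerivAt_tsum_mul_pow hτ ha hx'
    have h2 : (∑' k : ℕ, ((k : ℝ) + 1) * a (k + 1) * x ^ k) = A x * ∑' m, e m * x ^ m := by
      rw [hA, tsum_mul_tsum_eq_tsum_sum_range_of_summable_norm
        (summable_norm_mul_pow hτ.le ha hx') (summable_norm_mul_pow hτ.le he' hx')]
      refine tsum_congr fun k => ?_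
      rw [hrec, Finset.sum_mul]
      refine Finset.sum_congr rfl fun j hj => ?_
      have hjk : j + (k - j) = k := by have := Finset.mem_range.mp hj; omega
      conv_lhs => rw [← hjk, pow_add]
      rw [hjk]; ring
    rw [h2] at h1
    have h3 := h1.mul (hL x hx0 hx).neg.exp
    exact h3.congr_deriv (by ring)
  have hconst := constant_of_has_deriv_right_zero (f := fun x => A x * Real.exp (-L x))
    (a := 0) (b := u)
    (fun x hx => (hder x hx.1 ((mul_le_mul_of_nonneg_right hx.2 hτ.le).trans_lt
      hu)).continuousAt.continuousWithinAt)
    (fun x hx => (hder x hx.1 ((mul_le_mul_of_nonneg_right hx.2.le hτ.le).trans_lt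
      hu)).hasDerivWithinAt) u ⟨hu0, le_rfl⟩
  have hA0 : A 0 = a 0 := by
    rw [hA]
    simp only
    rw [tsum_eq_single 0 (fun k hk => by simp [hk])]
    simp
  have hval : A u = a 0 * Real.exp (L u - L 0) := by
    simp only [hA0] at hconst
    calc A u = A u * Real.exp (-L u) * Real.exp (L u) := by
          rw [mul_assoc, ← Real.exp_add]; simp
      _ = _ := by rw [hconst, mul_assoc, ← Real.exp_add]; congr 2; ring
  rw [← hval]
  exact (summable_norm_mul_pow hτ.le ha (by rwa [abs_of_nonneg hu0])).of_norm.hasSum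

/-! ### Series of Gamma densities -/

/-- The series `∑ a_k y^{α+k-1} / Γ(α+k)`, the formal inverse Laplace transform of
`∑ a_k s^{-(α+k)}`. -/
noncomputable def gammaSeries (α : ℝ) (a : ℕ → ℝ) (y : ℝ) : ℝ :=
  ∑' k : ℕ, a k * (y ^ (α + k - 1) / Real.Gamma (α + k))

theorem measurable_gammaSeries (α : ℝ) (a : ℕ → ℝ) : Measurable (gammaSeries α a) := by
  unfold gammaSeries
  exact Measurable.tsum fun k => by fun_prop

theorem integrable_tsum_of_summable_integral_norm {X : Type*} [MeasurableSpace X]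
    {m : Measure X} {F : ℕ → X → ℝ} (hF : ∀ k, Integrable (F k) m)
    (hs : Summable fun k => ∫ x, ‖F k x‖ ∂m) : Integrable (fun x => ∑' k, F k x) m := by
  refine ⟨(AEMeasurable.tsum fun k => (hF k).aemeasurable).aestronglyMeasurable, ?_⟩
  have hk : ∀ k, ∫⁻ x, ‖F k x‖ₑ ∂m = ENNReal.ofReal (∫ x, ‖F k x‖ ∂m) := fun k =>
    (ofReal_integral_norm_eq_lintegral_enorm (hF k)).symm
  calc ∫⁻ x, ‖∑' k, F k x‖ₑ ∂m ≤ ∫⁻ x, ∑' k, ‖F k x‖ₑ ∂m :=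
        lintegral_mono fun x => enorm_tsum_le_tsum_enorm
    _ = ∑' k, ∫⁻ x, ‖F k x‖ₑ ∂m := lintegral_tsum fun k => (hF k).1.enorm
    _ < ⊤ := by
        simp_rw [hk]
        exact hs.tsum_ofReal_lt_top

theorem integrableOn_gammaTerm {α s : ℝ} (hα : 0 < α) (hs : 0 < s) (k : ℕ) :
    IntegrableOn (fun y : ℝ => y ^ (α + k - 1) * Real.exp (-(s * y))) (Set.Ioi 0) := by
  have hα' : 0 < α + k := by positivity
  -- an integral with a nonzero value is not the junk value of a divergent one
  refine Integrable.of_integral_ne_zero ?_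
  rw [Real.integral_rpow_mul_exp_neg_mul_Ioi hα' hs]
  have := Real.Gamma_pos_of_pos hα'
  positivity

section Laplace

variable {α M τ s : ℝ} {a : ℕ → ℝ}

theorem integral_norm_gammaTerm (hα : 0 < α) (hs : 0 < s) (k : ℕ) :
    ∫ y in Set.Ioi 0, ‖a k * (y ^ (α + k - 1) / Real.Gamma (α + k)) * Real.exp (-(s * y))‖
      = |a k| * (1 / s) ^ (α + k) := by
  have hα' : 0 < α + k := by positivity
  have hG := Real.Gamma_pos_of_pos hα'
  have h : ∀ y ∈ Set.Ioi (0 : ℝ),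
      ‖a k * (y ^ (α + k - 1) / Real.Gamma (α + k)) * Real.exp (-(s * y))‖
        = |a k| / Real.Gamma (α + k) * (y ^ (α + k - 1) * Real.exp (-(s * y))) := by
    intro y hy
    have hy' : (0 : ℝ) < y := hy
    rw [norm_mul, norm_mul, Real.norm_eq_abs, Real.norm_of_nonneg (by positivity),
      Real.norm_of_nonneg (by positivity)]
    ring
  rw [setIntegral_congr_fun measurableSet_Ioi h, integral_const_mul,
    Real.integral_rpow_mul_exp_neg_mul_Ioi hα' hs]
  field_simp

theorem integral_gammaTerm (hα : 0 < α) (hs : 0 < s) (k : ℕ) :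
    ∫ y in Set.Ioi 0, a k * (y ^ (α + k - 1) / Real.Gamma (α + k)) * Real.exp (-(s * y))
      = a k * (1 / s) ^ (α + k) := by
  have hα' : 0 < α + k := by positivity
  have hG := Real.Gamma_pos_of_pos hα'
  have h : ∀ y : ℝ, a k * (y ^ (α + k - 1) / Real.Gamma (α + k)) * Real.exp (-(s * y))
        = a k / Real.Gamma (α + k) * (y ^ (α + k - 1) * Real.exp (-(s * y))) := by
    intro y; ring
  simp_rw [h]
  rw [integral_const_mul, Real.integral_rpow_mul_exp_neg_mul_Ioi hα' hs]
  field_simp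

theorem integrableOn_gammaTerm_mul (hα : 0 < α) (hs : 0 < s) (k : ℕ) :
    IntegrableOn (fun y => a k * (y ^ (α + k - 1) / Real.Gamma (α + k)) * Real.exp (-(s * y)))
      (Set.Ioi 0) := by
  have h := (integrableOn_gammaTerm hα hs k).const_mul (a k / Real.Gamma (α + k))
  refine h.congr (Filter.Eventually.of_forall fun y => ?_)
  simp only
  ring

theorem summable_abs_mul_rpow (hτ : 0 < τ)
    (ha : ∀ k, |a k| ≤ M * τ ^ k) (hs : τ < s) :
    Summable fun k : ℕ => |a k| * (1 / s) ^ (α + k) := by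
  have hs0 : 0 < s := hτ.trans hs
  have h := (summable_norm_mul_pow (u := 1 / s) hτ.le ha (by
    rw [abs_of_pos (by positivity), one_div, inv_mul_lt_iff₀ hs0]; simpa using hs)).mul_left
    ((1 / s) ^ α)
  refine h.congr fun k => ?_
  rw [Real.rpow_add (by positivity), Real.rpow_natCast, norm_mul, Real.norm_eq_abs,
    Real.norm_of_nonneg (by positivity)]
  ring

theorem integrableOn_gammaSeries_mul_exp (hα : 0 < α) (hτ : 0 < τ)
    (ha : ∀ k, |a k| ≤ M * τ ^ k) (hs : τ < s) :
    IntegrableOn (fun y => gammaSeries α a y * Real.exp (-(s * y))) (Set.Ioi 0) := by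
  have hs0 : 0 < s := hτ.trans hs
  unfold gammaSeries
  simp_rw [← tsum_mul_right]
  refine integrable_tsum_of_summable_integral_norm
    (fun k => integrableOn_gammaTerm_mul hα hs0 k) ?_
  simp_rw [integral_norm_gammaTerm hα hs0]
  exact summable_abs_mul_rpow hτ ha hs

theorem hasSum_laplace_gammaSeries (hα : 0 < α) (hτ : 0 < τ)
    (ha : ∀ k, |a k| ≤ M * τ ^ k) (hs : τ < s) :
    HasSum (fun k : ℕ => a k * (1 / s) ^ (α + k))
      (∫ y in Set.Ioi 0, gammaSeries α a y * Real.exp (-(s * y))) := by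
  have hs0 : 0 < s := hτ.trans hs
  unfold gammaSeries
  simp_rw [← tsum_mul_right]
  have h := hasSum_integral_of_summable_integral_norm
    (fun k => integrableOn_gammaTerm_mul (a := a) hα hs0 k) (by
      simp_rw [integral_norm_gammaTerm hα hs0]
      exact summable_abs_mul_rpow hτ ha hs)
  simpa only [integral_gammaTerm hα hs0] using h

/-- Termwise integration over `(0, y]`. The sum of the integrals of the absolute values is at most
`exp (s y)` times the corresponding sum for the Laplace transform at a point `s > τ`. -/
theorem hasSum_integral_Ioc_gammaSeries (hα : 0 < α) (hτ : 0 < τ)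
    (ha : ∀ k, |a k| ≤ M * τ ^ k) {y : ℝ} (hy : 0 ≤ y) :
    HasSum (fun k : ℕ => a k * (y ^ (α + k) / Real.Gamma (α + k + 1)))
      (∫ t in Set.Ioc 0 y, gammaSeries α a t) := by
  have hs0 : 0 < τ + 1 := by positivity
  have hint : ∀ k : ℕ, IntegrableOn (fun t : ℝ => a k * (t ^ (α + k - 1) / Real.Gamma (α + k)))
      (Set.Ioc 0 y) := by
    intro k
    have h : IntervalIntegrable (fun t : ℝ => t ^ (α + k - 1)) volume 0 y :=
      intervalIntegral.intervalIntegrable_rpow' (by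
        have : (0 : ℝ) ≤ k := by positivity
        linarith)
    exact (((intervalIntegrable_iff_integrableOn_Ioc_of_le hy).mp h).div_const _).const_mul _
  have hval : ∀ k : ℕ, ∫ t in Set.Ioc 0 y, a k * (t ^ (α + k - 1) / Real.Gamma (α + k))
      = a k * (y ^ (α + k) / Real.Gamma (α + k + 1)) := by
    intro k
    have hα' : 0 < α + k := by positivity
    have hG := Real.Gamma_pos_of_pos hα'
    rw [integral_const_mul, integral_div, ← intervalIntegral.integral_of_le hy,
      integral_rpow (Or.inl (by linarith)), Real.Gamma_add_one hα'.ne', sub_add_cancel,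
      Real.zero_rpow hα'.ne', sub_zero, div_div]
  have h := hasSum_integral_of_summable_integral_norm hint (by
    refine Summable.of_nonneg_of_le (fun k => integral_nonneg fun _ => norm_nonneg _)
      (fun k => ?_) ((summable_abs_mul_rpow (α := α) hτ ha (lt_add_one τ)).mul_left
        (Real.exp ((τ + 1) * y)))
    rw [← integral_norm_gammaTerm hα hs0, ← integral_const_mul]
    have hI : IntegrableOn _ _ volume := ((integrableOn_gammaTerm_mul (a := a) hα hs0 k).norm).const_mul
      (Real.exp ((τ + 1) * y))
    -- enlarge the integrand by `exp ((τ + 1) (y - t)) ≥ 1`, then the domain to `(0, ∞)`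
    refine (setIntegral_mono_on (hint k).norm (hI.mono_set Set.Ioc_subset_Ioi_self)
      measurableSet_Ioc fun t ht => ?_).trans
      (setIntegral_mono_set hI (Filter.Eventually.of_forall fun t => by positivity)
        (Filter.Eventually.of_forall Set.Ioc_subset_Ioi_self))
    rw [norm_mul _ (Real.exp _), Real.norm_of_nonneg (Real.exp_pos _).le, mul_left_comm,
      ← Real.exp_add]
    refine le_mul_of_one_le_right (norm_nonneg _) (Real.one_le_exp ?_)
    have := mul_le_mul_of_nonneg_left ht.2 hs0.le
    linarith)
  simp only [hval] at h
  exact h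

end Laplace

/-! ### Uniqueness of Laplace transforms -/

/-- Finite measures on `[-1, 1]` are determined by their moments: the characteristic
function is the sum of its Taylor series. -/
theorem ext_of_moments_of_abs_le_one {m₁ m₂ : Measure ℝ} [IsFiniteMeasure m₁]
    [IsFiniteMeasure m₂] (h₁ : ∀ᵐ x ∂m₁, |x| ≤ 1) (h₂ : ∀ᵐ x ∂m₂, |x| ≤ 1)
    (h : ∀ k : ℕ, ∫ x, x ^ k ∂m₁ = ∫ x, x ^ k ∂m₂) : m₁ = m₂ := by
  have key : ∀ (m : Measure ℝ) [IsFiniteMeasure m] (_ : ∀ᵐ x ∂m, |x| ≤ 1) (t : ℝ),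
      HasSum (fun k : ℕ => ((t * Complex.I) ^ k / (k.factorial : ℂ)) * ((∫ x, x ^ k ∂m : ℝ) : ℂ))
        (charFun m t) := by
    intro m _ hm t
    have hb : ∀ k : ℕ, ∀ᵐ x ∂m,
        ‖((t * Complex.I) ^ k / (k.factorial : ℂ)) * ((x ^ k : ℝ) : ℂ)‖
          ≤ |t| ^ k / k.factorial := by
      intro k
      filter_upwards [hm] with x hx
      rw [norm_mul, norm_div, norm_pow, norm_mul, Complex.norm_I, mul_one, Complex.norm_real,
        Complex.norm_real, norm_pow, Real.norm_eq_abs, Real.norm_eq_abs, Complex.norm_natCast]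
      exact mul_le_of_le_one_right (by positivity) (pow_le_one₀ (abs_nonneg _) hx)
    have hint : ∀ k : ℕ,
        Integrable (fun x : ℝ => ((t * Complex.I) ^ k / (k.factorial : ℂ)) * ((x ^ k : ℝ) : ℂ)) m :=
      fun k => Integrable.of_bound (Measurable.aestronglyMeasurable (by fun_prop)) _ (hb k)
    have hs := hasSum_integral_of_summable_integral_norm hint (by
      refine Summable.of_nonneg_of_le (fun k => integral_nonneg fun _ => norm_nonneg _)
        (fun k => ?_) ((Real.summable_pow_div_factorial |t|).mul_right (m.real Set.univ))
      calc ∫ x, ‖((t * Complex.I) ^ k / (k.factorial : ℂ)) * ((x ^ k : ℝ) : ℂ)‖ ∂m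
          ≤ ∫ _x, |t| ^ k / k.factorial ∂m :=
            integral_mono_ae (hint k).norm (integrable_const _) (hb k)
        _ = |t| ^ k / k.factorial * m.real Set.univ := by
            rw [integral_const, smul_eq_mul, mul_comm])
    have hval : ∀ k : ℕ, ∫ x, ((t * Complex.I) ^ k / (k.factorial : ℂ)) * ((x ^ k : ℝ) : ℂ) ∂m
        = ((t * Complex.I) ^ k / (k.factorial : ℂ)) * ((∫ x, x ^ k ∂m : ℝ) : ℂ) := by
      intro k
      rw [integral_const_mul, integral_complex_ofReal]
    simp only [hval] at hs
    rw [charFun_apply_real]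
    have hexp : ∀ x : ℝ, Complex.exp (t * x * Complex.I)
        = ∑' k : ℕ, ((t * Complex.I) ^ k / (k.factorial : ℂ)) * ((x ^ k : ℝ) : ℂ) := by
      intro x
      rw [Complex.exp_eq_exp_ℂ, NormedSpace.exp_eq_tsum_div]
      refine tsum_congr fun k => ?_
      push_cast
      ring
    simp only [hexp]
    exact hs
  refine Measure.ext_of_charFun (funext fun t => ?_)
  refine (key m₁ h₁ t).unique ?_
  simp only [h]
  exact key m₂ h₂ t

/-- Finite measures on `[0, ∞)` are determined by the values of their Laplace transforms at the
natural numbers, which are the moments of their images under `y ↦ exp (-y)`. -/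
theorem ext_of_laplace {m₁ m₂ : Measure ℝ} [IsFiniteMeasure m₁] [IsFiniteMeasure m₂]
    (h₁ : ∀ᵐ x ∂m₁, 0 ≤ x) (h₂ : ∀ᵐ x ∂m₂, 0 ≤ x)
    (h : ∀ k : ℕ, ∫ x, Real.exp (-(k * x)) ∂m₁ = ∫ x, Real.exp (-(k * x)) ∂m₂) : m₁ = m₂ := by
  have hmeas : Measurable fun x : ℝ => Real.exp (-x) := by fun_prop
  have hbd : ∀ m : Measure ℝ, (∀ᵐ x ∂m, 0 ≤ x) →
      ∀ᵐ x ∂(m.map fun x => Real.exp (-x)), |x| ≤ 1 := by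
    intro m hm
    rw [ae_map_iff hmeas.aemeasurable (measurableSet_le (by fun_prop) (by fun_prop))]
    filter_upwards [hm] with x hx
    rw [abs_of_pos (Real.exp_pos _)]
    exact Real.exp_le_one_iff.mpr (by linarith)
  have hmap : m₁.map (fun x => Real.exp (-x)) = m₂.map (fun x => Real.exp (-x)) := by
    refine ext_of_moments_of_abs_le_one (hbd _ h₁) (hbd _ h₂) fun k => ?_
    rw [integral_map hmeas.aemeasurable (by fun_prop),
      integral_map hmeas.aemeasurable (by fun_prop)]
    simp_rw [← Real.exp_nat_mul, mul_neg]
    exact h k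
  have hinv : ∀ m : Measure ℝ, (m.map fun x => Real.exp (-x)).map (fun x => -Real.log x) = m := by
    intro m
    rw [Measure.map_map (by fun_prop) hmeas]
    convert Measure.map_id
    ext x
    simp
  rw [← hinv m₁, hmap, hinv]

/-- Uniqueness for a measure and a signed density `F`: the negative part of `F` is added to the
measure. -/
theorem integral_eq_of_laplace_eq {m : Measure ℝ} [IsFiniteMeasure m] (hm : ∀ᵐ x ∂m, 0 ≤ x)
    {F : ℝ → ℝ} (hFm : Measurable F) (hF : IntegrableOn F (Set.Ioi 0))
    (h : ∀ k : ℕ, ∫ x, Real.exp (-(k * x)) ∂m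
      = ∫ x in Set.Ioi 0, F x * Real.exp (-(k * x)))
    {g : ℝ → ℝ} (hgm : Measurable g) (hg : Integrable g m)
    (hgF : IntegrableOn (fun x => g x * |F x|) (Set.Ioi 0)) :
    ∫ x, g x ∂m = ∫ x in Set.Ioi 0, F x * g x := by
  set ν : Measure ℝ := volume.restrict (Set.Ioi 0) with hν
  have hνpos : ∀ᵐ x ∂ν, 0 ≤ x := by
    filter_upwards [ae_restrict_mem measurableSet_Ioi] with x hx
    exact le_of_lt hx
  set mp := ν.withDensity fun x => ENNReal.ofReal (F x) with hmp
  set mn := ν.withDensity fun x => ENNReal.ofReal (-F x) with hmn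
  have : IsFiniteMeasure mp := isFiniteMeasure_withDensity_ofReal hF.2
  have : IsFiniteMeasure mn := isFiniteMeasure_withDensity_ofReal hF.neg.2
  have hipos : ∀ g : ℝ → ℝ, ∫ x, g x ∂mp = ∫ x, max (F x) 0 * g x ∂ν := by
    intro g
    rw [hmp, integral_withDensity_eq_integral_toReal_smul (by fun_prop) (by simp)]
    simp [ENNReal.toReal_ofReal']
  have hineg : ∀ g : ℝ → ℝ, ∫ x, g x ∂mn = ∫ x, max (-F x) 0 * g x ∂ν := by
    intro g
    rw [hmn, integral_withDensity_eq_integral_toReal_smul (by fun_prop) (by simp)]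
    simp [ENNReal.toReal_ofReal']
  have hdom : ∀ {g : ℝ → ℝ} {H : ℝ → ℝ}, AEStronglyMeasurable g ν → Measurable H →
      (∀ x, |H x| ≤ |F x|) → Integrable (fun x => g x * |F x|) ν →
      Integrable (fun x => H x * g x) ν := by
    intro g H hg hH hle hi
    refine hi.mono (hH.aestronglyMeasurable.mul hg) (Filter.Eventually.of_forall fun x => ?_)
    rw [norm_mul, norm_mul, mul_comm, Real.norm_eq_abs (H x), Real.norm_eq_abs |F x|, abs_abs]
    exact mul_le_mul_of_nonneg_left (hle x) (norm_nonneg _)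
  have hmaxp : ∀ x, |max (F x) 0| ≤ |F x| := fun x => by
    rw [abs_of_nonneg (le_max_right _ _)]; exact max_le (le_abs_self _) (abs_nonneg _)
  have hmaxn : ∀ x, |max (-F x) 0| ≤ |F x| := fun x => by
    rw [abs_of_nonneg (le_max_right _ _)]; exact max_le (neg_le_abs _) (abs_nonneg _)
  have hdiff : ∀ {g : ℝ → ℝ}, AEStronglyMeasurable g ν → Integrable (fun x => g x * |F x|) ν →
      ∫ x, g x ∂mp - ∫ x, g x ∂mn = ∫ x, F x * g x ∂ν := by
    intro g hg hi
    rw [hipos, hineg, ← integral_sub (hdom hg (by fun_prop) hmaxp hi)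
      (hdom hg (by fun_prop) hmaxn hi)]
    refine integral_congr_ae (Filter.Eventually.of_forall fun x => ?_)
    simp only
    rw [← sub_mul]
    congr 1
    rcases le_total (F x) 0 with h0 | h0
    · rw [max_eq_right h0, max_eq_left (by linarith)]; ring
    · rw [max_eq_left h0, max_eq_right (by linarith)]; ring
  have heq : m + mn = mp := by
    refine ext_of_laplace ?_ (withDensity_absolutelyContinuous _ _ hνpos) fun k => ?_
    · rw [ae_add_measure_iff]
      exact ⟨hm, withDensity_absolutelyContinuous _ _ hνpos⟩
    have hbd : ∀ x : ℝ, 0 ≤ x → ‖Real.exp (-(k * x))‖ ≤ 1 := fun x hx => by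
      rw [Real.norm_of_nonneg (Real.exp_pos _).le, Real.exp_le_one_iff, neg_nonpos]
      positivity
    have hint : ∀ m : Measure ℝ, IsFiniteMeasure m → (∀ᵐ x ∂m, 0 ≤ x) →
        Integrable (fun x => Real.exp (-(k * x))) m := fun m _ hm =>
      Integrable.of_bound (by fun_prop) 1 (hm.mono hbd)
    rw [integral_add_measure (hint m inferInstance hm)
      (hint mn inferInstance (withDensity_absolutelyContinuous _ _ hνpos)), h k,
      ← hdiff (g := fun x => Real.exp (-(k * x))) (by fun_prop) ?_]
    · ring
    · refine hF.abs.mono (by fun_prop) (hνpos.mono fun x hx => ?_)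
      rw [norm_mul]
      exact mul_le_of_le_one_left (norm_nonneg _) (hbd x hx)
  have hgn : Integrable g mn := by
    rw [hmn, integrable_withDensity_iff_integrable_smul' (by fun_prop) (by simp)]
    simpa [ENNReal.toReal_ofReal'] using hdom hgm.aestronglyMeasurable
      (H := fun x => max (-F x) 0) (by fun_prop) hmaxn hgF
  rw [← hdiff hgm.aestronglyMeasurable hgF, ← heq, integral_add_measure hg hgn]
  ring

/-- If a finite measure on `[0, ∞)` and a signed function `f` have the same Laplace transform at the
points `s + k`, where `f` need only be integrable with the weight `exp (-s x)`, then `f` is a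
density of the measure. -/
theorem measureReal_Iic_eq_of_laplace {ν : Measure ℝ} [IsFiniteMeasure ν] (hν : ∀ᵐ x ∂ν, 0 ≤ x)
    {f : ℝ → ℝ} (hfm : Measurable f) {s : ℝ} (hs : 0 ≤ s)
    (hf : IntegrableOn (fun x => f x * Real.exp (-(s * x))) (Set.Ioi 0))
    (h : ∀ k : ℕ, ∫ x, Real.exp (-((s + k) * x)) ∂ν
      = ∫ x in Set.Ioi 0, f x * Real.exp (-((s + k) * x))) (y : ℝ) :
    ν.real (Set.Iic y) = ∫ x in Set.Ioc 0 y, f x := by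
  have hexp : Integrable (fun x => Real.exp (-(s * x))) ν := by
    refine Integrable.of_bound (by fun_prop) 1 (hν.mono fun x hx => ?_)
    rw [Real.norm_of_nonneg (Real.exp_pos _).le, Real.exp_le_one_iff, neg_nonpos]
    positivity
  set m : Measure ℝ := ν.withDensity fun x => ENNReal.ofReal (Real.exp (-(s * x))) with hm
  have : IsFiniteMeasure m := isFiniteMeasure_withDensity_ofReal hexp.2
  have him : ∀ g : ℝ → ℝ, ∫ x, g x ∂m = ∫ x, Real.exp (-(s * x)) * g x ∂ν := by
    intro g
    rw [hm, integral_withDensity_eq_integral_toReal_smul (by fun_prop) (by simp)]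
    simp [ENNReal.toReal_ofReal, Real.exp_nonneg]
  -- the test function undoes the exponential weight on `(-∞, y]`
  set g : ℝ → ℝ := (Set.Iic y).indicator fun x => Real.exp (s * x) with hg
  have hgm : Measurable g := (by fun_prop : Measurable fun x => Real.exp (s * x)).indicator
    measurableSet_Iic
  have hgb : ∀ x, ‖g x‖ ≤ Real.exp (s * y) := by
    intro x
    rw [hg, Set.indicator_apply]
    split_ifs with hx
    · rw [Real.norm_of_nonneg (Real.exp_pos _).le]
      exact Real.exp_le_exp.mpr (mul_le_mul_of_nonneg_left hx hs)
    · simpa using Real.exp_nonneg _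
  have hcancel : ∀ x, Real.exp (-(s * x)) * g x = (Set.Iic y).indicator 1 x := by
    intro x
    rw [hg, Set.indicator_apply, Set.indicator_apply]
    split_ifs
    · rw [← Real.exp_add]; simp
    · simp
  have key := integral_eq_of_laplace_eq (m := m) (withDensity_absolutelyContinuous _ _ hν)
    (F := fun x => f x * Real.exp (-(s * x))) (by fun_prop) hf (fun k => by
      rw [him]
      simp_rw [mul_assoc, ← Real.exp_add]
      have he : ∀ x : ℝ, -(s * x) + -((k : ℝ) * x) = -((s + k) * x) := fun x => by ring
      simp_rw [he]
      exact h k) hgm (Integrable.of_bound hgm.aestronglyMeasurable _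
        (Filter.Eventually.of_forall hgb))
    (hf.abs.bdd_mul hgm.aestronglyMeasurable (Filter.Eventually.of_forall hgb))
  rw [him] at key
  simp_rw [mul_assoc, hcancel] at key
  rw [integral_indicator_one measurableSet_Iic] at key
  rw [key, ← Set.Ioi_inter_Iic, ← setIntegral_indicator measurableSet_Iic]
  refine integral_congr_ae (Filter.Eventually.of_forall fun x => ?_)
  by_cases hx : x ∈ Set.Iic y <;> simp [hx]

/-! ### The generating function of the coefficients -/

section Coefficients

variable {n : ℕ} {lam b : Fin n → ℝ}

/-- The power series of the derivative of
`x ↦ -(1/2) log (1 + x ρ) - (β²/2) (1 + x ρ)⁻¹`. With `ρ = (2 λ_i)⁻¹` and `β = b_i` its coefficients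
are the contribution of the index `i` to `(-1)^{m+1} d_{m+1}`. -/
theorem hasSum_logDeriv_quadratic {ρ β x : ℝ} (hx : |x * ρ| < 1) :
    HasSum (fun m : ℕ => (-1) ^ (m + 1) * ((1 / 2) * ((1 - ((m : ℝ) + 1) * β ^ 2) * ρ ^ (m + 1)))
        * x ^ m)
      (-(1 / 2) * (ρ / (1 + x * ρ)) + β ^ 2 / 2 * (ρ / (1 + x * ρ) ^ 2)) := by
  have hx' : ‖-(x * ρ)‖ < 1 := by rwa [norm_neg, Real.norm_eq_abs]
  have h0 := hasSum_choose_mul_geometric_of_norm_lt_one 0 hx'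
  have h1 := hasSum_choose_mul_geometric_of_norm_lt_one 1 hx'
  have hval : -(1 / 2) * (ρ / (1 + x * ρ)) + β ^ 2 / 2 * (ρ / (1 + x * ρ) ^ 2)
      = -(1 / 2) * ρ * (1 / (1 - -(x * ρ)) ^ (0 + 1))
        + β ^ 2 / 2 * ρ * (1 / (1 - -(x * ρ)) ^ (1 + 1)) := by
    simp only [sub_neg_eq_add]
    ring
  rw [hval]
  refine ((h0.mul_left (-(1 / 2) * ρ)).add (h1.mul_left (β ^ 2 / 2 * ρ))).congr_fun fun m => ?_
  have hpow : (-(x * ρ)) ^ m = (-1) ^ m * x ^ m * ρ ^ m := by rw [neg_pow, mul_pow]; ring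
  rw [hpow, Nat.choose_zero_right, Nat.choose_one_right]
  push_cast
  ring

/-- A common geometric bound for the `d_k` and the `(2 λ_i)⁻¹`. -/
theorem exists_geometric_bound (hlam : ∀ i, 0 < lam i) :
    ∃ τ : ℝ, 0 < τ ∧ (∀ k, |quadFormD lam b (k + 1)| ≤ τ ^ (k + 1)) ∧
      ∀ i, (2 * lam i)⁻¹ ≤ τ := by
  set R : ℝ := 1 + ∑ i, (2 * lam i)⁻¹ with hR
  set K : ℝ := 1 + ∑ i, (1 + b i ^ 2) with hK
  have hρ : ∀ i, 0 < (2 * lam i)⁻¹ := fun i => by have := hlam i; positivity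
  have hR1 : 1 ≤ R := by
    have : 0 ≤ ∑ i, (2 * lam i)⁻¹ := Finset.sum_nonneg fun i _ => (hρ i).le
    linarith
  have hK1 : 1 ≤ K := by
    have : 0 ≤ ∑ i, (1 + b i ^ 2) := Finset.sum_nonneg fun i _ => by positivity
    linarith
  have hρR : ∀ i, (2 * lam i)⁻¹ ≤ R := fun i => by
    have := Finset.single_le_sum (f := fun i => (2 * lam i)⁻¹) (fun i _ => (hρ i).le)
      (Finset.mem_univ i)
    linarith
  have hRτ : R ≤ 2 * R * K := by nlinarith
  refine ⟨2 * R * K, by positivity, fun k => ?_, fun i => (hρR i).trans hRτ⟩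
  have h2 : ((k : ℝ) + 1) ≤ 2 ^ (k + 1) := by
    exact_mod_cast (Nat.lt_two_pow_self (n := k + 1)).le
  calc |quadFormD lam b (k + 1)|
      ≤ (1 / 2) * ∑ i, |(1 - ((k + 1 : ℕ) : ℝ) * b i ^ 2) * ((2 * lam i) ^ (k + 1))⁻¹| := by
        rw [quadFormD, abs_mul, abs_of_pos (by norm_num : (0 : ℝ) < 1 / 2)]
        gcongr
        exact Finset.abs_sum_le_sum_abs _ _
    _ ≤ 1 * ∑ i, (1 + b i ^ 2) * (2 * R) ^ (k + 1) := by
        refine mul_le_mul (by norm_num) (Finset.sum_le_sum fun i _ => ?_)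
          (Finset.sum_nonneg fun i _ => abs_nonneg _) (by norm_num)
        · rw [abs_mul, ← inv_pow, abs_of_pos (pow_pos (hρ i) _), mul_pow, ← mul_assoc]
          have h3 : |1 - ((k + 1 : ℕ) : ℝ) * b i ^ 2| ≤ (1 + b i ^ 2) * 2 ^ (k + 1) := by
            push_cast
            rw [abs_le]
            constructor <;>
              nlinarith [sq_nonneg (b i), mul_le_mul_of_nonneg_right h2 (sq_nonneg (b i))]
          have h4 : ((2 * lam i)⁻¹) ^ (k + 1) ≤ R ^ (k + 1) :=
            pow_le_pow_left₀ (hρ i).le (hρR i) _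
          have := hρ i
          gcongr
    _ ≤ K * (2 * R) ^ (k + 1) := by
        rw [one_mul, ← Finset.sum_mul]
        gcongr
        linarith
    _ ≤ K ^ (k + 1) * (2 * R) ^ (k + 1) := by
        gcongr
        exact le_self_pow₀ hK1 (by omega)
    _ = (2 * R * K) ^ (k + 1) := by rw [← mul_pow]; congr 1; ring

/-- The recursion for `a_k = (-1)^k c_k` with `e_m = (-1)^{m+1} d_{m+1}`. -/
theorem quadFormC_signed_recursion (lam b : Fin n → ℝ) (k : ℕ) :
    ((k : ℝ) + 1) * ((-1) ^ (k + 1) * quadFormC lam b (k + 1)) =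
      ∑ j ∈ Finset.range (k + 1), (-1) ^ j * quadFormC lam b j *
        ((-1) ^ (k - j + 1) * quadFormD lam b (k - j + 1)) := by
  have hk : (k : ℝ) + 1 ≠ 0 := by positivity
  rw [quadFormC, Fin.sum_univ_eq_sum_range
    (fun j => quadFormD lam b (k + 1 - j) * quadFormC lam b j)]
  rw [show ((k : ℝ) + 1) * ((-1) ^ (k + 1) * (1 / ((k : ℝ) + 1) *
      ∑ j ∈ Finset.range (k + 1), quadFormD lam b (k + 1 - j) * quadFormC lam b j)) =
      (-1) ^ (k + 1) * ∑ j ∈ Finset.range (k + 1),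
        quadFormD lam b (k + 1 - j) * quadFormC lam b j by field_simp, Finset.mul_sum]
  refine Finset.sum_congr rfl fun j hj => ?_
  have hjk : j ≤ k := Nat.lt_succ_iff.mp (Finset.mem_range.mp hj)
  have h1 : k + 1 - j = k - j + 1 := by omega
  have h2 : (-1 : ℝ) ^ (k + 1) = (-1) ^ j * (-1) ^ (k - j + 1) := by
    rw [← pow_add]; congr 1; omega
  rw [h1, h2]
  ring

/-- The generating function of `(-1)^k c_k` near `0`. Its value at `u = 1 / s`, multiplied by
`s^{-n/2}`, is the Laplace transform at `s` of the quadratic form. -/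
theorem hasSum_quadFormC {τ u : ℝ} (hlam : ∀ i, 0 < lam i) (hτ : 0 < τ)
    (hd : ∀ k, |quadFormD lam b (k + 1)| ≤ τ ^ (k + 1)) (hρ : ∀ i, (2 * lam i)⁻¹ ≤ τ)
    (hu0 : 0 ≤ u) (hu : u * τ < 1) :
    HasSum (fun k => (-1) ^ k * quadFormC lam b k * u ^ k)
      (∏ i, (2 * lam i + u) ^ (-(1 / 2) : ℝ) *
        Real.exp (-(b i ^ 2 / 2) * (2 * lam i / (2 * lam i + u)))) := by
  set ρ : Fin n → ℝ := fun i => (2 * lam i)⁻¹ with hρdef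
  have hρ0 : ∀ i, 0 < ρ i := fun i => by have := hlam i; positivity
  -- a logarithm of the generating function, up to a constant
  set L : ℝ → ℝ := fun x => ∑ i, (-(1 / 2) * Real.log (1 + x * ρ i)
    - b i ^ 2 / 2 * (1 + x * ρ i)⁻¹) with hLdef
  have hpos : ∀ x, 0 ≤ x → ∀ i, 0 < 1 + x * ρ i := fun x hx i => by
    have := hρ0 i
    positivity
  have hL : ∀ x, 0 ≤ x → x * τ < 1 →
      HasDerivAt L (∑' m : ℕ, (-1) ^ (m + 1) * quadFormD lam b (m + 1) * x ^ m) x := by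
    intro x hx0 hx
    have hsum : HasSum (fun m : ℕ => (-1) ^ (m + 1) * quadFormD lam b (m + 1) * x ^ m)
        (∑ i, (-(1 / 2) * (ρ i / (1 + x * ρ i)) + b i ^ 2 / 2 * (ρ i / (1 + x * ρ i) ^ 2))) := by
      have := hasSum_sum (s := Finset.univ) fun i _ =>
        hasSum_logDeriv_quadratic (ρ := ρ i) (β := b i) (x := x) (by
          rw [abs_of_nonneg (mul_nonneg hx0 (hρ0 i).le)]
          exact (mul_le_mul_of_nonneg_left (hρ i) hx0).trans_lt hx)
      refine this.congr_fun fun m => ?_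
      rw [quadFormD]
      simp_rw [Finset.mul_sum, Finset.sum_mul, hρdef, inv_pow]
      push_cast
      rfl
    rw [hsum.tsum_eq, hLdef]
    refine HasDerivAt.fun_sum fun i _ => ?_
    have h1 : HasDerivAt (fun x : ℝ => 1 + x * ρ i) (ρ i) x := by
      simpa using ((hasDerivAt_id x).mul_const (ρ i)).const_add 1
    have hne := (hpos x hx0 i).ne'
    refine (((h1.log hne).const_mul (-(1 / 2))).sub
      ((h1.inv hne).const_mul (b i ^ 2 / 2))).congr_deriv ?_
    ring
  have h := hasSum_exp_of_recursion (a := fun k => (-1) ^ k * quadFormC lam b k)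
    (e := fun m => (-1) ^ (m + 1) * quadFormD lam b (m + 1)) hτ
    (fun m => by simpa [abs_mul] using hd m) (quadFormC_signed_recursion lam b) hL hu0 hu
  convert h using 1
  have hL0 : L 0 = -(1 / 2) * ∑ i, b i ^ 2 := by
    simp [hLdef, Finset.mul_sum]
    refine Finset.sum_congr rfl fun i _ => by ring
  rw [quadFormC, hL0, pow_zero, one_mul, mul_right_comm, ← Real.exp_add, add_sub_cancel, hLdef,
    Real.exp_sum, ← Finset.prod_mul_distrib]
  refine Finset.prod_congr rfl fun i _ => ?_
  have hl := hlam i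
  have hp := hpos u hu0 i
  have hfac : 2 * lam i + u = 2 * lam i * (1 + u * ρ i) := by
    simp only [hρdef]; field_simp
  rw [sub_eq_add_neg, Real.exp_add, mul_comm (-(1 / 2)) (Real.log _), ← Real.rpow_def_of_pos hp,
    hfac, Real.mul_rpow (by positivity) hp.le, mul_comm (_ * _) ((2 * lam i) ^ _), mul_assoc]
  congr 3
  field_simp

theorem abs_signed_quadFormC_le {τ : ℝ} (hτ : 0 < τ)
    (hd : ∀ k, |quadFormD lam b (k + 1)| ≤ τ ^ (k + 1)) (k : ℕ) :
    |(-1) ^ k * quadFormC lam b k| ≤ |quadFormC lam b 0| * τ ^ k := by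
  have h := abs_le_geometric_of_recursion (a := fun k => (-1) ^ k * quadFormC lam b k)
    (e := fun m => (-1) ^ (m + 1) * quadFormD lam b (m + 1)) hτ.le
    (fun m => by simpa [abs_mul] using hd m) (quadFormC_signed_recursion lam b) k
  simpa using h

end Coefficients

/-! ### The Laplace transform of the quadratic form -/

theorem integral_exp_neg_sq_gaussianReal {c β : ℝ} (hc : 0 ≤ c) :
    ∫ z, Real.exp (-(c * (z + β) ^ 2)) ∂(gaussianReal 0 1)
      = (1 + 2 * c) ^ (-(1 / 2) : ℝ) * Real.exp (-(β ^ 2 / 2) * (2 * c / (1 + 2 * c))) := by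
  have h1 : 0 < 1 + 2 * c := by positivity
  rw [integral_gaussianReal_eq_integral_smul one_ne_zero]
  -- complete the square
  have hsq : ∀ z : ℝ, gaussianPDFReal 0 1 z • Real.exp (-(c * (z + β) ^ 2))
      = ((√(2 * Real.pi))⁻¹ * Real.exp (-(β ^ 2 / 2) * (2 * c / (1 + 2 * c)))) *
        Real.exp (-(c + 1 / 2) * (z + 2 * c * β / (1 + 2 * c)) ^ 2) := by
    intro z
    simp only [gaussianPDFReal, smul_eq_mul, NNReal.coe_one, mul_one, sub_zero]
    rw [mul_assoc, mul_assoc, ← Real.exp_add, ← Real.exp_add]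
    congr 2
    field_simp
    ring
  simp_rw [hsq]
  rw [integral_const_mul,
    integral_add_right_eq_self (fun z => Real.exp (-(c + 1 / 2) * z ^ 2)), integral_gaussian]
  have h2 : Real.pi / (c + 1 / 2) = 2 * Real.pi * (1 + 2 * c)⁻¹ := by
    field_simp
    ring
  have h3 : √(2 * Real.pi) ≠ 0 := by positivity
  rw [h2, Real.sqrt_mul (by positivity : 0 ≤ 2 * Real.pi), Real.rpow_neg h1.le, Real.sqrt_inv,
    Real.sqrt_eq_rpow (1 + 2 * c)]
  field_simp

section QuadForm

variable {n : ℕ} {S P : Matrix (Fin n) (Fin n) ℝ} {μ : EuclideanSpace ℝ (Fin n)}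
  {lam b : Fin n → ℝ}

theorem IsQuadFormParams.transpose_mul_mul (hS : S.PosSemidef)
    (hP : IsQuadFormParams 1 S μ P lam b) : P.transpose * S * P = Matrix.diagonal lam := by
  rw [← hP.diagonalizes, mul_one, CFC.sqrt_mul_sqrt_self S hS.nonneg]

theorem IsQuadFormParams.lam_pos (hS : S.PosDef) (hP : IsQuadFormParams 1 S μ P lam b) (i : Fin n) :
    0 < lam i := by
  have h : (Matrix.diagonal lam).PosDef := by
    rw [← hP.transpose_mul_mul hS.posSemidef, ← Matrix.conjTranspose_eq_transpose_of_trivial]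
    refine hS.conjTranspose_mul_mul_same (Matrix.mulVec_injective_of_isUnit ?_)
    exact (Matrix.isUnit_iff_isUnit_det _).mpr (Matrix.isUnit_det_of_right_inverse hP.orthogonal)
  exact Matrix.posDef_diagonal_iff.mp h i

theorem map_orthogonal_stdGaussian (hP : P * P.transpose = 1) :
    (stdGaussian (EuclideanSpace ℝ (Fin n))).map (Matrix.toEuclideanCLM (𝕜 := ℝ) P)
      = stdGaussian (EuclideanSpace ℝ (Fin n)) := by
  have hP' : P.transpose * P = 1 := mul_eq_one_comm.mp hP
  have hnorm : ∀ x : EuclideanSpace ℝ (Fin n), ‖Matrix.toEuclideanCLM (𝕜 := ℝ) P x‖ = ‖x‖ := by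
    intro x
    rw [← sq_eq_sq₀ (norm_nonneg _) (norm_nonneg _), EuclideanSpace.real_norm_sq_eq,
      EuclideanSpace.real_norm_sq_eq, Matrix.ofLp_toEuclideanCLM]
    have h : (P.mulVec x.ofLp) ⬝ᵥ (P.mulVec x.ofLp) = x.ofLp ⬝ᵥ x.ofLp := by
      rw [Matrix.dotProduct_mulVec, Matrix.vecMul_mulVec, hP', Matrix.vecMul_one]
    simpa [dotProduct, pow_two] using h
  let f : EuclideanSpace ℝ (Fin n) →ₗᵢ[ℝ] EuclideanSpace ℝ (Fin n) :=
    ⟨(Matrix.toEuclideanCLM (𝕜 := ℝ) P).toLinearMap, hnorm⟩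
  exact stdGaussian_map (f.toLinearIsometryEquiv rfl)

/-- In the coordinates `z = Pᵀ S^{-1/2} (v - μ)` the squared norm of `v` is
`∑ i, λ_i (z_i + b_i)²`. -/
theorem norm_sq_eq_sum_of_isQuadFormParams (hS : S.PosDef) (hP : IsQuadFormParams 1 S μ P lam b)
    (z : Fin n → ℝ) :
    ‖μ + Matrix.toEuclideanCLM (𝕜 := ℝ) (CFC.sqrt S)
      (Matrix.toEuclideanCLM (𝕜 := ℝ) P (WithLp.toLp 2 z))‖ ^ 2
      = ∑ i, lam i * (z i + b i) ^ 2 := by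
  set R := CFC.sqrt S with hR
  have hRR : R * R = S := CFC.sqrt_mul_sqrt_self S hS.posSemidef.nonneg
  have hRT : R.transpose = R := by
    rw [← Matrix.conjTranspose_eq_transpose_of_trivial]
    exact (CFC.sqrt_nonneg S).isSelfAdjoint
  have hRdet : IsUnit R.det := by
    have : IsUnit (R.det * R.det) := by
      rw [← Matrix.det_mul, hRR]
      exact hS.det_pos.ne'.isUnit
    exact isUnit_of_mul_isUnit_left this
  have hμ : μ.ofLp = R.mulVec (P.mulVec b) := by
    rw [hP.shift, Matrix.mulVec_mulVec _ P, hP.orthogonal, Matrix.one_mulVec, Matrix.mulVec_mulVec,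
      Matrix.mul_nonsing_inv _ hRdet, Matrix.one_mulVec]
  have hv : (μ + Matrix.toEuclideanCLM (𝕜 := ℝ) R
      (Matrix.toEuclideanCLM (𝕜 := ℝ) P (WithLp.toLp 2 z))).ofLp = (R * P).mulVec (z + b) := by
    rw [WithLp.ofLp_add, Matrix.ofLp_toEuclideanCLM, Matrix.ofLp_toEuclideanCLM, hμ,
      Matrix.mulVec_add, Matrix.mulVec_mulVec, Matrix.mulVec_mulVec, add_comm]
  rw [EuclideanSpace.real_norm_sq_eq, hv]
  have h : ((R * P).mulVec (z + b)) ⬝ᵥ ((R * P).mulVec (z + b))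
      = (z + b) ⬝ᵥ Matrix.vecMul (z + b) (Matrix.diagonal lam) := by
    rw [Matrix.dotProduct_mulVec, Matrix.vecMul_mulVec, Matrix.transpose_mul, hRT, mul_assoc,
      ← mul_assoc R, hRR, ← mul_assoc, hP.transpose_mul_mul hS.posSemidef, dotProduct_comm]
  calc _ = ((R * P).mulVec (z + b)) ⬝ᵥ ((R * P).mulVec (z + b)) := by
        simp [dotProduct, pow_two]
    _ = _ := by
        rw [h]
        simp only [dotProduct, Matrix.vecMul_diagonal, Pi.add_apply]
        exact Finset.sum_congr rfl fun i _ => by ring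

theorem integral_exp_neg_norm_sq_multivariateGaussian (hS : S.PosDef)
    (hP : IsQuadFormParams 1 S μ P lam b) {s : ℝ} (hs : 0 ≤ s) :
    ∫ v, Real.exp (-(s * ‖v‖ ^ 2)) ∂(multivariateGaussian μ S)
      = ∏ i, (1 + 2 * (s * lam i)) ^ (-(1 / 2) : ℝ) *
        Real.exp (-(b i ^ 2 / 2) * (2 * (s * lam i) / (1 + 2 * (s * lam i)))) := by
  rw [multivariateGaussian, integral_map (by fun_prop) (by fun_prop),
    ← map_orthogonal_stdGaussian hP.orthogonal, integral_map (by fun_prop) (by fun_prop),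
    ← map_pi_eq_stdGaussian, integral_map (by fun_prop) (by fun_prop)]
  simp_rw [norm_sq_eq_sum_of_isQuadFormParams hS hP, Finset.mul_sum, ← Finset.sum_neg_distrib,
    Real.exp_sum]
  rw [integral_fintype_prod_eq_prod (f := fun i (z : ℝ) =>
    Real.exp (-(s * (lam i * (z + b i) ^ 2))))]
  refine Finset.prod_congr rfl fun i _ => ?_
  rw [← integral_exp_neg_sq_gaussianReal (mul_nonneg hs (hP.lam_pos hS i).le)]
  simp_rw [mul_assoc]

end QuadForm

/-! ### Differences of Gaussian vectors and intersections of balls -/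

theorem hasLaw_sub_multivariateGaussian {Ω : Type*} [MeasurableSpace Ω] {Pr : Measure Ω}
    [IsProbabilityMeasure Pr] {n : ℕ} {x s : Ω → EuclideanSpace ℝ (Fin n)}
    {μx μs : EuclideanSpace ℝ (Fin n)} {Sx Ss : Matrix (Fin n) (Fin n) ℝ}
    (hSx : Sx.PosSemidef) (hSs : Ss.PosSemidef)
    (hx : HasLaw x (multivariateGaussian μx Sx) Pr)
    (hs : HasLaw s (multivariateGaussian μs Ss) Pr) (hxs : IndepFun x s Pr) :
    HasLaw (fun ω => x ω - s ω) (multivariateGaussian (μx - μs) (Sx + Ss)) Pr := by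
  refine ⟨hx.aemeasurable.sub hs.aemeasurable, Measure.ext_of_charFun (funext fun t => ?_)⟩
  have hind : IndepFun x (fun ω => (-1 : ℝ) • s ω) Pr :=
    hxs.comp measurable_id (measurable_const_smul (-1 : ℝ))
  have h := congrFun (hind.charFun_map_fun_add_eq_mul hx.aemeasurable
    (hs.aemeasurable.const_smul (-1 : ℝ))) t
  have hsub : (fun ω => x ω - s ω) = fun ω => x ω + (-1 : ℝ) • s ω := by
    funext ω
    simp [sub_eq_add_neg]
  rw [hsub]
  refine h.trans ?_
  have hneg : charFun (Pr.map ((-1 : ℝ) • s)) t = charFun (Pr.map s) ((-1 : ℝ) • t) :=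
    charFun_map_smul_comp hs.aemeasurable (-1) t
  rw [Pi.mul_apply, hneg, hx.map_eq, hs.map_eq,
    charFun_multivariateGaussian hSx, charFun_multivariateGaussian hSs,
    charFun_multivariateGaussian (hSx.add hSs), ← Complex.exp_add]
  congr 1
  rw [Matrix.add_mulVec, dotProduct_add, inner_sub_right]
  simp [Matrix.mulVec_neg]
  ring

theorem collisionEvent_eq {Ω : Type*} {n : ℕ} (x s : Ω → EuclideanSpace ℝ (Fin n)) {r₁ s₁ : ℝ}
    (hr₁ : 0 ≤ r₁) (hs₁ : 0 ≤ s₁) :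
    collisionEvent x s r₁ s₁ = {ω | ‖x ω - s ω‖ ^ 2 ≤ (r₁ + s₁) ^ 2} := by
  ext ω
  simp only [collisionEvent, Set.mem_ofPred_eq]
  rw [sq_le_sq₀ (norm_nonneg _) (by positivity), ← dist_eq_norm]
  constructor
  · rintro ⟨p, hp, hq⟩
    rw [Metric.mem_closedBall] at hp hq
    calc dist (x ω) (s ω) ≤ dist (x ω) p + dist p (s ω) := dist_triangle _ _ _
      _ ≤ r₁ + s₁ := add_le_add (by rwa [dist_comm]) hq
  · intro h
    obtain ⟨p, hp, hq⟩ := exists_dist_le_le hr₁ hs₁ (by rwa [add_comm] : dist (x ω) (s ω) ≤ s₁ + r₁)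
    exact ⟨p, by rwa [Metric.mem_closedBall, dist_comm], by rwa [Metric.mem_closedBall]⟩

/-! ### The distribution function -/

/-- The distribution function of `‖w‖²` for a Gaussian vector `w`, in positive dimension: its law
and the Gamma series with coefficients `(-1)^k c_k` have the same Laplace transform. -/
theorem hasSum_quadFormCdfTerm {n : ℕ} (hn : 0 < n) {S P : Matrix (Fin n) (Fin n) ℝ}
    {μ : EuclideanSpace ℝ (Fin n)} {lam b : Fin n → ℝ} (hS : S.PosDef)
    (hP : IsQuadFormParams 1 S μ P lam b) {y : ℝ} (hy : 0 ≤ y) :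
    HasSum (quadFormCdfTerm lam b y)
      ((multivariateGaussian μ S).real {v | ‖v‖ ^ 2 ≤ y}) := by
  have hα : (0 : ℝ) < (n : ℝ) / 2 := by positivity
  have hlam := hP.lam_pos hS
  obtain ⟨τ, hτ, hd, hρ⟩ := exists_geometric_bound (b := b) hlam
  have ha := abs_signed_quadFormC_le hτ hd
  set a : ℕ → ℝ := fun k => (-1) ^ k * quadFormC lam b k with hadef
  set ν : Measure ℝ := (multivariateGaussian μ S).map fun v => ‖v‖ ^ 2 with hν
  have hmeas : Measurable fun v : EuclideanSpace ℝ (Fin n) => ‖v‖ ^ 2 := by fun_prop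
  have : IsProbabilityMeasure ν := Measure.isProbabilityMeasure_map hmeas.aemeasurable
  have hlap : ∀ s, τ < s → ∫ x, Real.exp (-(s * x)) ∂ν
      = ∫ x in Set.Ioi 0, gammaSeries ((n : ℝ) / 2) a x * Real.exp (-(s * x)) := by
    intro s hs
    have hs0 : 0 < s := hτ.trans hs
    rw [hν, integral_map hmeas.aemeasurable (by fun_prop),
      integral_exp_neg_norm_sq_multivariateGaussian hS hP hs0.le]
    have h1 := hasSum_laplace_gammaSeries hα hτ ha hs
    have h2 := (hasSum_quadFormC (u := 1 / s) hlam hτ hd hρ (by positivity) (by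
      rw [one_div, inv_mul_lt_iff₀ hs0]; simpa using hs)).mul_left ((1 / s) ^ ((n : ℝ) / 2))
    refine Eq.trans ?_ (h2.unique (h1.congr_fun fun k => ?_))
    · have hpow : (1 / s) ^ ((n : ℝ) / 2) = ∏ _i : Fin n, (1 / s) ^ (1 / 2 : ℝ) := by
        rw [Finset.prod_const, Finset.card_univ, Fintype.card_fin, ← Real.rpow_mul_natCast
          (by positivity)]
        congr 1
        ring
      rw [hpow, ← Finset.prod_mul_distrib]
      refine Finset.prod_congr rfl fun i _ => ?_
      have hl := hlam i
      have h3 : 1 + 2 * (s * lam i) = s * (2 * lam i + 1 / s) := by field_simp; ring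
      rw [h3, Real.mul_rpow hs0.le (by positivity), one_div s, Real.inv_rpow hs0.le,
        Real.rpow_neg hs0.le, mul_assoc]
      congr 4
      field_simp
    · rw [Real.rpow_add (by positivity), Real.rpow_natCast]
      ring
  have hcdf := measureReal_Iic_eq_of_laplace (ν := ν) (by
      rw [hν, ae_map_iff hmeas.aemeasurable measurableSet_Ici]
      exact Filter.Eventually.of_forall fun v => by positivity)
    (measurable_gammaSeries ((n : ℝ) / 2) a) (s := τ + 1) (by positivity)
    (integrableOn_gammaSeries_mul_exp hα hτ ha (lt_add_one τ))
    (fun k => hlap _ (by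
      have : (0 : ℝ) ≤ k := k.cast_nonneg
      linarith)) y
  have hset : (multivariateGaussian μ S).real {v | ‖v‖ ^ 2 ≤ y} = ν.real (Set.Iic y) := by
    rw [hν, map_measureReal_apply hmeas measurableSet_Iic]
    rfl
  rw [hset, hcdf]
  exact hasSum_integral_Ioc_gammaSeries hα hτ ha hy

/-- In dimension zero only the term `k = 0` is nonzero. -/
theorem hasSum_quadFormCdfTerm_zero (lam b : Fin 0 → ℝ) (y : ℝ) :
    HasSum (quadFormCdfTerm lam b y) 1 := by
  have hc : ∀ k, quadFormC lam b (k + 1) = 0 := fun k => by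
    rw [quadFormC]
    simp [quadFormD]
  have h0 : quadFormCdfTerm lam b y 0 = 1 := by
    simp [quadFormCdfTerm, quadFormC]
  rw [← h0]
  refine hasSum_single 0 fun k hk => ?_
  obtain ⟨k, rfl⟩ := Nat.exists_eq_succ_of_ne_zero hk
  simp [quadFormCdfTerm, hc]

theorem mainTheorem2 {Ω : Type*} [MeasurableSpace Ω] (Pr : Measure Ω) [IsProbabilityMeasure Pr]
    {n : ℕ} (x s : Ω → EuclideanSpace ℝ (Fin n))
    (μx μs : EuclideanSpace ℝ (Fin n)) (Sx Ss : Matrix (Fin n) (Fin n) ℝ)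
    (hSx : Sx.PosSemidef) (hSs : Ss.PosSemidef) (hS : (Sx + Ss).PosDef)
    (hx : HasLaw x (multivariateGaussian μx Sx) Pr)
    (hs : HasLaw s (multivariateGaussian μs Ss) Pr)
    (hxs : IndepFun x s Pr)
    (r₁ s₁ : ℝ) (hr₁ : 0 ≤ r₁) (hs₁ : 0 ≤ s₁) :
    HasLaw (fun ω => x ω - s ω) (multivariateGaussian (μx - μs) (Sx + Ss)) Pr ∧
    collisionEvent x s r₁ s₁ = {ω | ‖x ω - s ω‖ ^ 2 ≤ (r₁ + s₁) ^ 2} ∧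
    ∀ (P : Matrix (Fin n) (Fin n) ℝ) (lam b : Fin n → ℝ),
      IsQuadFormParams 1 (Sx + Ss) (μx - μs) P lam b →
      HasSum (quadFormCdfTerm lam b ((r₁ + s₁) ^ 2))
        (Pr.real {ω | ‖x ω - s ω‖ ^ 2 ≤ (r₁ + s₁) ^ 2}) := by
  have hlaw := hasLaw_sub_multivariateGaussian hSx hSs hx hs hxs
  refine ⟨hlaw, collisionEvent_eq x s hr₁ hs₁, fun P lam b hP => ?_⟩
  rcases Nat.eq_zero_or_pos n with rfl | hn
  · have huniv : {ω | ‖x ω - s ω‖ ^ 2 ≤ (r₁ + s₁) ^ 2} = Set.univ := by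
      refine Set.eq_univ_of_forall fun ω => ?_
      have h0 : x ω - s ω = 0 := Subsingleton.elim _ _
      rw [Set.mem_ofPred_eq, h0, norm_zero, zero_pow two_ne_zero]
      positivity
    rw [huniv, probReal_univ]
    exact hasSum_quadFormCdfTerm_zero lam b _
  · rw [hlaw.measureReal_eq (p := fun v => ‖v‖ ^ 2 ≤ (r₁ + s₁) ^ 2)
      (measurableSet_le (by fun_prop) (by fun_prop))]
    exact hasSum_quadFormCdfTerm hn hS hP (by positivity)
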